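/- **Theorem.** For a finite simple graph $G=(V,E)$ and $\lambda=(\lambda_v)_{v\in V}\in\mathbb{C}^V$, let $$Z_G(\lambda)=\sum_{\substack{I\subseteq V\\ I\text{ independent}}}\ \prod_{v\in I}\lambda_v$$ be the multivariate independence polynomial of $G$. For an integer $\Delta\ge 3$ put $\lambda_\Delta=\frac{(\Delta-1)^{\Delta-1}}{(\Delta-2)^{\Delta}}$, and for $A\subseteq\mathbb{C}$ and $\delta>0$ put $\mathcal{N}(A,\delta)=\{z\in\mathbb{C} : |z-a|<\delta\text{ for some }a\in A\}$. Let $\Delta\ge 3$ be an integer. Then for every $\varepsilon>0$ there exists $\delta>0$ such that for every finite simple graph $G=(V,E)$ of maximum degree at most $\Delta$ and every $\lambda\in\mathbb{C}^V$ satisfying $\lambda_v\in\mathcal{N}([0,(1-\varepsilon)\lambda_\Delta),\delta)$ for each $v\in V$, we have $Z_G(\lambda)\neq 0$. -/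

import Mathlib

/-- The multivariate independence polynomial `Z_G(w) = ∑_{I ⊆ V independent} ∏_{v ∈ I} w_v` of a
finite graph `G = (V, E)`, evaluated at the vertex weights `w ∈ ℂ^V`. -/
noncomputable def indepPoly {V : Type*} [Fintype V] (G : SimpleGraph V) (w : V → ℂ) : ℂ :=
  open Classical in
  ∑ I ∈ (Finset.univ : Finset (Finset V)).filter (fun I : Finset V => G.IsIndepSet (I : Set V)),
    ∏ v ∈ I, w v

/-- The critical value `λ_Δ = (Δ - 1)^(Δ - 1) / (Δ - 2)^Δ`, used for `Δ ≥ 3`. -/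
noncomputable def lambdaCrit (Δ : ℕ) : ℝ :=
  ((Δ : ℝ) - 1) ^ (Δ - 1) / ((Δ : ℝ) - 2) ^ Δ

/-!
Zero-freeness of the multivariate independence polynomial near `[0, (1 - ε) λ_Δ)`.

Write `d = Δ - 1` and let `Z(S)` be the weight of the independent sets inside `S ⊆ V`. The deletion
recurrence `Z(S ∪ {v}) = Z(S) + w_v Z(S \ N(v))`, with the neighbours of `v` in `S` removed one at a
time, expresses the logarithmic ratio of `v`, that is, a `W'` with `Z(S ∪ {v}) = e^{W'} Z(S)`, as
`log (1 + w_v e^{-W})`, where `W` is the sum of the logarithmic ratios of these neighbours. If some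
neighbour of `v` is outside `S`, there are at most `d` summands, and the same holds for each removed
vertex, because its neighbour `v` is absent by then. So it suffices to find a region which contains
`0`, lies where `Re e^W > 1/2`, and is mapped into itself by `log (1 + c e^{-W})` for `W` a sum of at
most `d` of its elements (`exists_log_ratio_of_insert`, `indepSum_ne_zero`). A vertex with `d + 1`
remaining neighbours needs the bound `1/2`: two points `e^W` of the region then cannot add up to `1`.

The region is `{a + ib : -1/4 ≤ a ≤ L, |b| ≤ η (1 + y a)}` with `η` small. It is convex, so a sum of
`d` of its elements is `d` times one of them, and the question concerns a single variable: the map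
`a ↦ log (1 + l e^{-d a})` has to contract relative to the width `1 + y a`. With `x = l e^{-d a}`
this is the inequality `d x / (1 + x) * (1 + y a) < 1 + y log (1 + x)`. For the slope
`y = (d - 1) / (2 - (d - 1) log (d / (d - 1)))` and `l = λ_Δ`, multiplying by `1 + x` and moving
everything to the right gives a convex function of `x` that vanishes together with its derivative at
`x = 1 / (d - 1)` (`critical_inequality`). For `l` bounded away from `λ_Δ` compactness then yields
a uniform slack (`exists_uniform_slack`). For complex `W` and `c` the deviation from the linearised
map is `O(η²)`, which the slack of order `η` absorbs (`exists_invariant_region`).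
-/

/-! ### The deletion recurrence -/

/-- The total weight `Z(S)` of the independent sets contained in `S`, that is, the independence
polynomial of the subgraph of `G` induced on `S`. -/
noncomputable def indepSum {V : Type*} (G : SimpleGraph V) (w : V → ℂ) (S : Finset V) : ℂ :=
  open Classical in
  ∑ I ∈ S.powerset.filter (fun I : Finset V => G.IsIndepSet (I : Set V)), ∏ v ∈ I, w v

section Recurrence

variable {V : Type*} (G : SimpleGraph V) (w : V → ℂ)

lemma indepPoly_eq_indepSum_univ [Fintype V] : indepPoly G w = indepSum G w Finset.univ := by
  classical
  simp only [indepPoly, indepSum, Finset.powerset_univ]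

lemma indepSum_empty : indepSum G w ∅ = 1 := by
  classical
  simp [indepSum, Finset.filter_singleton, SimpleGraph.isIndepSet_iff]

lemma indepSum_eq_sum_ite [DecidableEq V] [DecidableRel G.Adj] (S : Finset V) :
    indepSum G w S = ∑ I ∈ S.powerset, if G.IsIndepSet (I : Set V) then ∏ v ∈ I, w v else 0 := by
  rw [indepSum, Finset.sum_filter]
  exact Finset.sum_congr rfl fun I _ => by congr

/-- The deletion recurrence `Z(S ∪ {v}) = Z(S) + w_v Z(S \ N(v))`. -/
lemma indepSum_insert [DecidableEq V] [DecidableRel G.Adj] {v : V} {S : Finset V} (hv : v ∉ S) :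
    indepSum G w (insert v S) =
      indepSum G w S + w v * indepSum G w (S.filter fun u => ¬ G.Adj v u) := by
  have key : ∀ t ⊆ S, (G.IsIndepSet ((insert v t : Finset V) : Set V) ↔
      t ⊆ (S.filter fun u => ¬ G.Adj v u) ∧ G.IsIndepSet (t : Set V)) := by
    intro t ht
    have hvt : v ∉ t := fun h => hv (ht h)
    simp only [SimpleGraph.isIndepSet_iff, Finset.coe_insert]
    have : Std.Symm fun a b => ¬ G.Adj a b := ⟨fun a b h h' => h h'.symm⟩
    rw [Set.pairwise_insert_of_symm]
    constructor
    · rintro ⟨h1, h2⟩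
      refine ⟨fun u hu => Finset.mem_filter.2 ⟨ht hu, h2 u hu ?_⟩, h1⟩
      rintro rfl
      exact hvt hu
    · rintro ⟨h1, h2⟩
      exact ⟨h2, fun u hu _ => (Finset.mem_filter.1 (h1 hu)).2⟩
  simp only [indepSum_eq_sum_ite]
  rw [Finset.sum_powerset_insert hv, Finset.mul_sum]
  congr 1
  symm
  refine Finset.sum_subset_zero_on_sdiff (Finset.powerset_mono.2 (Finset.filter_subset _ _)) ?_ ?_
  · intro t ht
    rw [Finset.mem_sdiff, Finset.mem_powerset, Finset.mem_powerset] at ht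
    exact if_neg fun h => ht.2 ((key t ht.1).1 h).1
  · intro t ht
    rw [Finset.mem_powerset] at ht
    have htS : t ⊆ S := ht.trans (Finset.filter_subset _ _)
    by_cases h : G.IsIndepSet (t : Set V)
    · rw [if_pos h, if_pos ((key t htS).2 ⟨ht, h⟩), Finset.prod_insert fun h => hv (htS h)]
    · rw [if_neg h, if_neg fun h' => h ((key t htS).1 h').2, mul_zero]

end Recurrence

/-! ### The contraction inequality on the real line -/

/-- The slope of the width function `a ↦ 1 + y a`, for `d = Δ - 1`: the choice for which the
contraction inequality at `λ_Δ` is an equality to second order at the fixed point `1 / (d - 1)`. -/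
noncomputable def widthSlope (d : ℝ) : ℝ := (d - 1) / (2 - (d - 1) * Real.log (d / (d - 1)))

lemma log_ratio_le {d : ℝ} (hd : 1 < d) : (d - 1) * Real.log (d / (d - 1)) ≤ 1 := by
  have h1 : 0 < d - 1 := by linarith
  have h := Real.log_le_sub_one_of_pos (show 0 < d / (d - 1) by positivity)
  calc (d - 1) * Real.log (d / (d - 1)) ≤ (d - 1) * (d / (d - 1) - 1) := by gcongr
    _ = 1 := by field_simp; ring

lemma widthSlope_pos {d : ℝ} (hd : 1 < d) : 0 < widthSlope d := by
  have := log_ratio_le hd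
  exact div_pos (by linarith) (by linarith)

/-- The tangent line inequality for the convex function `t ↦ t log t`. -/
lemma mul_log_sub_log_ge {t s : ℝ} (ht : 0 < t) (hs : 0 < s) :
    t - s ≤ t * (Real.log t - Real.log s) := by
  have h := Real.one_sub_inv_le_log_of_pos (show 0 < t / s by positivity)
  rw [Real.log_div ht.ne' hs.ne'] at h
  calc t - s = t * (1 - (t / s)⁻¹) := by field_simp
    _ ≤ _ := by gcongr

/-- The contraction inequality at the critical value. The difference of the two sides is convex in
`x`, and it vanishes to second order at `x = 1 / (d - 1)`. -/
lemma critical_inequality {d x Λ : ℝ} (hd : 1 < d) (hx : 0 < x)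
    (hΛ : Real.log Λ = Real.log (1 / (d - 1)) + d * Real.log (d / (d - 1))) :
    x * (d + widthSlope d * Real.log Λ) - widthSlope d * (x * Real.log x) ≤
      (1 + x) * (1 + widthSlope d * Real.log (1 + x)) := by
  have h1 : 0 < d - 1 := by linarith
  have hy := widthSlope_pos hd
  have hyp : widthSlope d * (2 - (d - 1) * Real.log (d / (d - 1))) = d - 1 := by
    have := log_ratio_le hd
    exact div_mul_cancel₀ _ (by linarith)
  have t1 := mul_log_sub_log_ge (t := 1 + x) (s := d / (d - 1)) (by positivity) (by positivity)
  have t2 := mul_log_sub_log_ge hx (show 0 < 1 / (d - 1) by positivity)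
  rw [hΛ]
  generalize Real.log (d / (d - 1)) = p at *
  generalize Real.log (1 / (d - 1)) = q at *
  generalize widthSlope d = y at *
  have t3 := mul_le_mul_of_nonneg_left (add_le_add t1 t2) hy.le
  have e1 : d / (d - 1) = 1 + 1 / (d - 1) := by field_simp; ring
  rw [e1] at t3
  have he : (d - 1) * (1 / (d - 1)) = 1 := by field_simp
  generalize 1 / (d - 1) = e at *
  have hz : 1 + y * (p - 2 * e) = 0 := by
    have : (d - 1) * (1 + y * (p - 2 * e)) = 0 := by linear_combination -hyp - 2 * y * he
    exact (mul_eq_zero.1 this).resolve_left h1.ne'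
  have hz' : (1 - (d - 1) * x) * (1 + y * (p - 2 * e)) = 0 := by rw [hz, mul_zero]
  linear_combination t3 - hz' + 2 * x * y * he

lemma log_lambdaCrit {d : ℕ} (hd : 2 ≤ d) :
    0 < lambdaCrit (d + 1) ∧ Real.log (lambdaCrit (d + 1)) =
      Real.log (1 / ((d : ℝ) - 1)) + d * Real.log ((d : ℝ) / ((d : ℝ) - 1)) := by
  have hd' : (2 : ℝ) ≤ d := by exact_mod_cast hd
  have h1 : (0 : ℝ) < (d : ℝ) - 1 := by linarith
  have h0 : (0 : ℝ) < d := by linarith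
  have e : lambdaCrit (d + 1) = (1 / ((d : ℝ) - 1)) * ((d : ℝ) / ((d : ℝ) - 1)) ^ d := by
    have e1 : ((d : ℝ) + 1) - 1 = d := by ring
    have e2 : ((d : ℝ) + 1) - 2 = d - 1 := by ring
    simp only [lambdaCrit, Nat.cast_add, Nat.cast_one, e1, e2, Nat.add_sub_cancel]
    rw [div_pow, pow_succ]
    field_simp
  rw [e]
  refine ⟨by positivity, ?_⟩
  rw [Real.log_mul (by positivity) (by positivity), Real.log_pow]

/-- Uniform slack in the contraction inequality below the critical value. Here `A` is the sum of `d`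
logarithmic ratios, `x = l e^{-A}` is the next ratio, and the inequality says that the derivative of
the recursion shrinks the width `1 + y a` by a definite amount. -/
lemma exists_uniform_slack {d M Λ X : ℝ} (hd : 1 < d) (hM : 0 < M) (hMΛ : M < Λ)
    (hΛ : Real.log Λ = Real.log (1 / (d - 1)) + d * Real.log (d / (d - 1))) (hX : 0 ≤ X) :
    ∃ m : ℝ, 0 < m ∧ ∀ l A : ℝ, 0 ≤ l → l ≤ M → l * Real.exp (-A) ≤ X →
      l * Real.exp (-A) / (1 + l * Real.exp (-A)) * (d + widthSlope d * A) + m ≤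
        1 + widthSlope d * Real.log (1 + l * Real.exp (-A)) := by
  have hy := widthSlope_pos hd
  set y := widthSlope d with hydef
  let Φ : ℝ → ℝ := fun x =>
    (1 + x) * (1 + y * Real.log (1 + x)) - (x * (d + y * Real.log M) - y * (x * Real.log x))
  have hcont : ContinuousOn Φ (Set.Icc 0 X) := by
    have h1 : ContinuousOn (fun x : ℝ => Real.log (1 + x)) (Set.Icc 0 X) :=
      ContinuousOn.log (by fun_prop) fun x hx => by
        have := hx.1
        positivity
    have h2 : Continuous fun x : ℝ => x * Real.log x := Real.continuous_mul_log
    fun_prop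
  have hpos : ∀ x, 0 ≤ x → 0 < Φ x := by
    intro x hx
    rcases hx.eq_or_lt with rfl | hx
    · simp [Φ]
    · have h := critical_inequality hd hx hΛ
      have hlog : Real.log M < Real.log Λ := Real.log_lt_log hM hMΛ
      have : x * (y * Real.log M) < x * (y * Real.log Λ) := by gcongr
      simp only [Φ]
      rw [← hydef] at h
      linarith
  obtain ⟨x₀, hx₀, hmin⟩ := isCompact_Icc.exists_isMinOn (Set.nonempty_Icc.2 hX) hcont
  refine ⟨Φ x₀ / (1 + X), div_pos (hpos _ hx₀.1) (by linarith), fun l A hl hlM hle => ?_⟩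
  set x := l * Real.exp (-A) with hxdef
  have hx : 0 ≤ x := by positivity
  have hm : Φ x₀ ≤ Φ x := hmin ⟨hx, hle⟩
  have hup : x * (d + y * A) ≤ x * (d + y * Real.log M) - y * (x * Real.log x) := by
    rcases hl.eq_or_lt with rfl | hl
    · simp [hxdef]
    · have hlx : Real.log x = Real.log l - A := by
        rw [hxdef, Real.log_mul hl.ne' (Real.exp_pos _).ne', Real.log_exp]; ring
      have : Real.log l ≤ Real.log M := Real.log_le_log hl hlM
      have h2 : x * (y * Real.log l) ≤ x * (y * Real.log M) := by gcongr
      rw [hlx]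
      linarith
  have h3 : Φ x₀ / (1 + X) ≤ Φ x / (1 + x) :=
    div_le_div₀ (hpos x hx).le hm (by linarith) (by linarith)
  have h4 : Φ x / (1 + x) ≤ ((1 + x) * (1 + y * Real.log (1 + x)) - x * (d + y * A)) / (1 + x) := by
    gcongr
    simp only [Φ]
    linarith
  have h5 : ((1 + x) * (1 + y * Real.log (1 + x)) - x * (d + y * A)) / (1 + x) =
      1 + y * Real.log (1 + x) - x / (1 + x) * (d + y * A) := by
    field_simp
  linarith

/-! ### An invariant complex region -/

/-- First-order expansion of `log (1 + u)` for `u` close to a point of the circular arc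
`x e^{-iθ}`, with an error that is uniform in `x ≥ 0`. -/
lemma norm_log_one_add_sub_le {x θ r : ℝ} {τ : ℂ} (hx : 0 ≤ x) (hr : r ≤ 1 / 4) (hθ : |θ| ≤ r)
    (hτ : ‖τ‖ ≤ r ^ 2) :
    1 + (x * Complex.exp (-(θ * Complex.I)) + τ) ≠ 0 ∧
    ‖Complex.log (1 + (x * Complex.exp (-(θ * Complex.I)) + τ)) -
      (Real.log (1 + x) - (x / (1 + x) * θ : ℝ) * Complex.I)‖ ≤ 4 * r ^ 2 := by
  have hr0 : 0 ≤ r := (abs_nonneg _).trans hθ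
  have hx1 : 0 < 1 + x := by linarith
  have hx1c : (1 + x : ℂ) ≠ 0 := by exact_mod_cast hx1.ne'
  set z : ℂ := -(θ * Complex.I) with hz
  have hnz : ‖z‖ ≤ r := by simpa [hz] using hθ
  set g : ℂ := Complex.exp z - 1 - z with hg
  have hgn : ‖g‖ ≤ r ^ 2 := by
    have := Complex.norm_exp_sub_one_sub_id_le (x := z) (by linarith)
    exact this.trans (by gcongr)
  set q : ℝ := x / (1 + x) with hq
  have hq0 : 0 ≤ q := by positivity
  have hq1 : q ≤ 1 := (div_le_one hx1).2 (by linarith)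
  set τ' : ℂ := τ / (1 + x) with hτ'
  have hτ'n : ‖τ'‖ ≤ r ^ 2 := by
    rw [hτ', norm_div]
    have : ‖(1 + x : ℂ)‖ = 1 + x := by
      rw [← Complex.ofReal_one, ← Complex.ofReal_add, Complex.norm_real, Real.norm_of_nonneg hx1.le]
    rw [this]
    exact (div_le_self (norm_nonneg _) (by linarith)).trans hτ
  set s : ℂ := q * (z + g) + τ' with hs
  have hqc : ∀ c : ℂ, ‖(q : ℂ) * c‖ ≤ ‖c‖ := fun c => by
    rw [norm_mul, Complex.norm_real, Real.norm_of_nonneg hq0]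
    exact mul_le_of_le_one_left (norm_nonneg _) hq1
  have hsn : ‖s‖ ≤ 3 / 2 * r := by
    have h1 : ‖s‖ ≤ ‖z‖ + ‖g‖ + ‖τ'‖ :=
      (norm_add_le _ _).trans (add_le_add_left ((hqc _).trans (norm_add_le _ _)) _)
    nlinarith
  have hslt : ‖s‖ ≤ 3 / 8 := by linarith
  -- Factor out `1 + x`: the quotient `1 + s` is close to `1` uniformly in `x`.
  have hfac : 1 + (x * Complex.exp z + τ) = ((1 + x : ℝ) : ℂ) * (1 + s) := by
    rw [hs, hg, hτ', hq]
    push_cast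
    field_simp
    ring
  have hs1 : 1 + s ≠ 0 := by
    intro h
    have : s = -1 := by linear_combination h
    rw [this] at hslt
    norm_num at hslt
  refine ⟨by rw [hfac]; exact mul_ne_zero (by exact_mod_cast hx1.ne') hs1, ?_⟩
  rw [hfac, Complex.log_ofReal_mul hx1 hs1]
  have hlog : ‖Complex.log (1 + s) - s‖ ≤ 2 * r ^ 2 := by
    refine (Complex.norm_log_one_add_sub_self_le (by linarith)).trans ?_
    have h1 : (1 - ‖s‖)⁻¹ ≤ 8 / 5 := by
      rw [show (8 / 5 : ℝ) = (5 / 8)⁻¹ by norm_num]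
      exact inv_anti₀ (by norm_num) (by linarith)
    have h0 : 0 ≤ (1 - ‖s‖)⁻¹ := inv_nonneg.2 (by linarith)
    calc ‖s‖ ^ 2 * (1 - ‖s‖)⁻¹ / 2 ≤ (3 / 2 * r) ^ 2 * (8 / 5) / 2 := by gcongr
      _ ≤ 2 * r ^ 2 := by nlinarith [sq_nonneg r]
  have hdec : (Real.log (1 + x) : ℂ) + Complex.log (1 + s) -
      (Real.log (1 + x) - (q * θ : ℝ) * Complex.I) =
      (Complex.log (1 + s) - s) + q * g + τ' := by
    rw [hs, hz]
    push_cast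
    ring
  rw [hdec]
  have := norm_add₃_le (a := Complex.log (1 + s) - s) (b := q * g) (c := τ')
  have := hqc g
  linarith

/-- The `k`-fold sumset of the thin convex neighbourhood of `[0, L]` whose points `a + ib` satisfy
`|b| ≤ η (1 + y a)`; the margin `1/4` on the left leaves room for complex weights near `0`. -/
def logRegion (y L η k : ℝ) : Set ℂ :=
  {W | -(k / 4) ≤ W.re ∧ W.re ≤ k * L ∧ |W.im| ≤ η * (k + y * W.re)}

lemma zero_mem_logRegion (y L η : ℝ) : (0 : ℂ) ∈ logRegion y L η 0 := by
  simp [logRegion]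

lemma add_mem_logRegion {y L η j k : ℝ} {W W' : ℂ} (h : W ∈ logRegion y L η j)
    (h' : W' ∈ logRegion y L η k) : W + W' ∈ logRegion y L η (j + k) := by
  obtain ⟨h1, h2, h3⟩ := h
  obtain ⟨h1', h2', h3'⟩ := h'
  refine ⟨?_, ?_, ?_⟩ <;> simp only [Complex.add_re, Complex.add_im]
  · linarith
  · linarith
  · linarith [abs_add_le W.im W'.im]

lemma logRegion_mono {y L η j k : ℝ} (hL : 0 ≤ L) (hη : 0 ≤ η) (hjk : j ≤ k) :
    logRegion y L η j ⊆ logRegion y L η k := by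
  rintro W ⟨h1, h2, h3⟩
  exact ⟨by linarith, h2.trans (by gcongr), h3.trans (by gcongr)⟩

/-- Quadratic errors are absorbed: a slack `m` in the contraction inequality, multiplied by `η`,
dominates the error `4 (B η)²` in both the imaginary and the real part. -/
lemma width_bound {y η B m p u v : ℝ} (hy : 0 ≤ y) (hη : 0 < η) (hη1 : η ≤ 1)
    (hm : 4 * B ^ 2 * (1 + y) * η ≤ m) (huv : u - 4 * (B * η) ^ 2 ≤ v) (hp : p + m ≤ 1 + y * u) :
    η * p + 4 * (B * η) ^ 2 ≤ η * (1 + y * v) := by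
  have h1 : y * (u - 4 * (B * η) ^ 2) ≤ y * v := by gcongr
  have h2 : 4 * (B * η) ^ 2 * y * η ≤ 4 * (B * η) ^ 2 * y * 1 := by gcongr
  have h3 := mul_le_mul_of_nonneg_left hm hη.le
  have h4 := mul_le_mul_of_nonneg_left hp hη.le
  have h5 := mul_le_mul_of_nonneg_left h1 hη.le
  linear_combination h2 + h3 + h4 + h5

/-- The region is mapped into itself by the recursion: a sum `W` of `d` logarithmic ratios is sent
to `log (1 + λ e^{-W})`. Errors of order `η²` are absorbed by a slack of order `η`. -/
lemma exists_invariant_region {d M Λ : ℝ} (hd : 1 < d) (hM : 0 < M) (hMΛ : M < Λ)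
    (hΛ : Real.log Λ = Real.log (1 / (d - 1)) + d * Real.log (d / (d - 1))) :
    ∃ L η δ : ℝ, 0 ≤ L ∧ 0 < η ∧ 0 < δ ∧
      (∀ W ∈ logRegion (widthSlope d) L η 1, 1 / 2 < (Complex.exp W).re) ∧
      ∀ c ∈ Metric.thickening δ (Complex.ofReal '' Set.Ico (0 : ℝ) M),
        ∀ W ∈ logRegion (widthSlope d) L η d, ∃ W' ∈ logRegion (widthSlope d) L η 1,
          1 + c * Complex.exp (-W) = Complex.exp W' := by
  have hy := widthSlope_pos hd
  -- `X` bounds `l e^{-a}` for `l ≤ M` and `a ≥ -d/4`.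
  set X := M * Real.exp (d / 4) with hX
  have hX0 : 0 < X := by positivity
  obtain ⟨m, hm, hslack⟩ := exists_uniform_slack hd hM hMΛ hΛ hX0.le
  set y := widthSlope d
  set L := Real.log (1 + X) + 1 / 4 with hL
  have hL0 : 0 ≤ L := by
    have := Real.log_nonneg (show 1 ≤ 1 + X by linarith)
    linarith
  -- `B η` bounds the imaginary part of a sum of `d` elements of the region.
  set B := d * (1 + y * L) with hB
  have hyL : 0 ≤ y * L := by positivity
  have hB1 : 1 ≤ B := by nlinarith
  have hB1' : 1 + y * L ≤ B := by nlinarith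
  obtain ⟨η, hη, hη1, hη2⟩ : ∃ η : ℝ, 0 < η ∧ B * η ≤ 1 / 4 ∧ 4 * B ^ 2 * (1 + y) * η ≤ m := by
    have hB0 : 0 < B := by linarith
    refine ⟨min (1 / (4 * B)) (m / (4 * B ^ 2 * (1 + y))), by positivity, ?_, ?_⟩
    · calc _ ≤ B * (1 / (4 * B)) := by gcongr; exact min_le_left _ _
        _ = 1 / 4 := by field_simp
    · calc _ ≤ 4 * B ^ 2 * (1 + y) * (m / (4 * B ^ 2 * (1 + y))) := by
            gcongr; exact min_le_right _ _
        _ = m := by field_simp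
  have hηle : η ≤ 1 := by nlinarith
  set r := B * η with hr
  have hr0 : 0 < r := by positivity
  refine ⟨L, η, r ^ 2 * Real.exp (-(d / 4)), hL0, hη, by positivity, ?_, ?_⟩
  · rintro W ⟨h1, h2, h3⟩
    have him : |W.im| ≤ 1 / 4 := by
      refine h3.trans (le_trans ?_ hη1)
      rw [hr, mul_comm B]
      have : y * W.re ≤ y * L := by gcongr; linarith
      gcongr
      linarith
    have hcos := Real.one_sub_sq_div_two_le_cos (x := W.im)
    have hsq : W.im ^ 2 ≤ (1 / 4) ^ 2 := sq_le_sq' (by linarith [abs_le.1 him]) (abs_le.1 him).2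
    have hexp : 3 / 4 ≤ Real.exp W.re := by linarith [Real.add_one_le_exp W.re]
    rw [Complex.exp_re]
    nlinarith
  · rintro c hc W ⟨h1, h2, h3⟩
    obtain ⟨_, ⟨l, ⟨hl0, hlM⟩, rfl⟩, hcl⟩ := Metric.mem_thickening_iff.1 hc
    set x := l * Real.exp (-W.re) with hx
    have hx0 : 0 ≤ x := by positivity
    have hexpW : Real.exp (-W.re) ≤ Real.exp (d / 4) := Real.exp_le_exp.2 (by linarith)
    have hxX : x ≤ X := by rw [hx, hX]; gcongr
    have hθ : |W.im| ≤ r := by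
      refine h3.trans ?_
      have : y * W.re ≤ y * (d * L) := by gcongr
      calc η * (d + y * W.re) ≤ η * (d + y * (d * L)) := by gcongr
        _ = r := by rw [hr, hB]; ring
    have hτ : ‖(c - l) * Complex.exp (-W)‖ ≤ r ^ 2 := by
      rw [norm_mul, Complex.norm_exp, Complex.neg_re]
      rw [dist_eq_norm] at hcl
      calc _ ≤ r ^ 2 * Real.exp (-(d / 4)) * Real.exp (d / 4) := by gcongr
        _ = r ^ 2 := by rw [mul_assoc, ← Real.exp_add]; simp
    have hu : c * Complex.exp (-W) =
        x * Complex.exp (-(W.im * Complex.I)) + (c - l) * Complex.exp (-W) := by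
      have : Complex.exp (-W) =
          Complex.exp (-W.re : ℝ) * Complex.exp (-(W.im * Complex.I)) := by
        rw [← Complex.exp_add]
        congr 1
        push_cast
        linear_combination -(Complex.re_add_im W).symm
      rw [hx, Complex.ofReal_mul, Complex.ofReal_exp, this]
      ring
    obtain ⟨hne, hlog⟩ := norm_log_one_add_sub_le hx0 hη1 hθ hτ
    rw [← hu] at hne hlog
    refine ⟨Complex.log (1 + c * Complex.exp (-W)), ?_, (Complex.exp_log hne).symm⟩
    have hre := (Complex.abs_re_le_norm _).trans hlog
    have him := (Complex.abs_im_le_norm _).trans hlog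
    generalize Complex.log (1 + c * Complex.exp (-W)) = W' at *
    simp only [Complex.sub_re, Complex.sub_im, Complex.ofReal_re, Complex.ofReal_im, Complex.mul_re,
      Complex.mul_im, Complex.I_re, Complex.I_im, mul_zero, mul_one, sub_zero, zero_sub, add_zero,
      sub_neg_eq_add] at hre him
    have hlx0 : 0 ≤ Real.log (1 + x) := Real.log_nonneg (by linarith)
    have hlxX : Real.log (1 + x) ≤ Real.log (1 + X) := Real.log_le_log (by linarith) (by linarith)
    have hr2 : 4 * r ^ 2 ≤ 1 / 4 := by nlinarith
    obtain ⟨hre1, hre2⟩ := abs_le.1 hre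
    refine ⟨by linarith, by linarith, ?_⟩
    have hs := hslack l W.re hl0 hlM.le hxX
    rw [← hx] at hs
    set q := x / (1 + x) with hq
    have hq0 : 0 ≤ q := by positivity
    have i1 : |W'.im| ≤ q * |W.im| + 4 * r ^ 2 := by
      have := abs_sub_abs_le_abs_sub W'.im (-(q * W.im))
      rw [abs_neg, abs_mul, abs_of_nonneg hq0, sub_neg_eq_add] at this
      linarith
    have i2 : q * |W.im| ≤ η * (q * (d + y * W.re)) := by
      rw [mul_left_comm]
      gcongr
    exact i1.trans ((add_le_add_left i2 _).trans
      (width_bound hy.le hη hηle hη2 (by linarith) hs))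

/-! ### Induction over vertex subsets -/

section Induction

variable {V : Type*} {G : SimpleGraph V} {w : V → ℂ} {y L η : ℝ}

open Classical in
/-- Removing the vertices of `T` one at a time: each step contributes one logarithmic ratio, and
their sum lies in the `|T|`-fold sumset. -/
lemma exists_log_ratio_of_union {S T : Finset V} (hST : Disjoint S T)
    (h : ∀ t ∈ T, ∀ U ⊆ S ∪ T, t ∉ U →
      ∃ W ∈ logRegion y L η 1, indepSum G w (insert t U) = Complex.exp W * indepSum G w U) :
    ∃ W ∈ logRegion y L η T.card, indepSum G w (S ∪ T) = Complex.exp W * indepSum G w S := by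
  induction T using Finset.induction_on with
  | empty => exact ⟨0, by simpa using zero_mem_logRegion y L η, by simp⟩
  | insert t T ht ih =>
    rw [Finset.disjoint_insert_right] at hST
    have hsub : S ∪ T ⊆ S ∪ insert t T := Finset.union_subset_union_right (Finset.subset_insert _ _)
    obtain ⟨W, hW, e⟩ := ih hST.2 fun t' ht' U hU =>
      h t' (Finset.mem_insert_of_mem ht') U (hU.trans hsub)
    obtain ⟨W', hW', e'⟩ := h t (Finset.mem_insert_self _ _) (S ∪ T) hsub (by simp [ht, hST.1])
    refine ⟨W + W', ?_, ?_⟩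
    · rw [Finset.card_insert_of_notMem ht]
      push_cast
      exact add_mem_logRegion hW hW'
    · rw [Finset.union_insert, e', e, Complex.exp_add]
      ring

open Classical in
/-- If `v` has a neighbour outside `S` then it has at most `d` neighbours in `S`. -/
lemma card_filter_adj_le [Fintype V] [DecidableRel G.Adj] {d : ℕ} (hG : G.maxDegree ≤ d + 1)
    (v : V) (S : Finset V) : (S.filter (G.Adj v)).card ≤ d + 1 ∧
      ∀ u, G.Adj v u → u ∉ S → (S.filter (G.Adj v)).card ≤ d := by
  have hdeg : (G.neighborFinset v).card ≤ d + 1 := (G.degree_le_maxDegree v).trans hG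
  have hsub : S.filter (G.Adj v) ⊆ G.neighborFinset v := fun a ha => by
    simpa using (Finset.mem_filter.1 ha).2
  refine ⟨(Finset.card_le_card hsub).trans hdeg, fun u hu huS => ?_⟩
  have : (S.filter (G.Adj v)).card < (G.neighborFinset v).card :=
    Finset.card_lt_card ⟨hsub, fun h => huS (Finset.mem_filter.1 (h (by simpa using hu))).1⟩
  omega

open Classical in
/-- The logarithmic ratio at a vertex with at most `d` remaining neighbours lies in the region, by
induction on the number of remaining vertices. -/
lemma exists_log_ratio_of_insert [Fintype V] [DecidableRel G.Adj] {d : ℕ}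
    (hG : G.maxDegree ≤ d + 1) (hL : 0 ≤ L) (hη : 0 ≤ η)
    (hinv : ∀ v, ∀ W ∈ logRegion y L η d, ∃ W' ∈ logRegion y L η 1,
      1 + w v * Complex.exp (-W) = Complex.exp W') (S : Finset V) :
    ∀ v ∉ S, (S.filter (G.Adj v)).card ≤ d →
      ∃ W ∈ logRegion y L η 1, indepSum G w (insert v S) = Complex.exp W * indepSum G w S := by
  induction S using Finset.strongInduction with
  | H S ih =>
    intro v hv hcard
    have hun : S.filter (fun u => ¬ G.Adj v u) ∪ S.filter (G.Adj v) = S := by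
      rw [Finset.union_comm, Finset.filter_union_filter_not_eq]
    obtain ⟨W, hW, e⟩ := exists_log_ratio_of_union (G := G) (w := w) (y := y) (L := L) (η := η)
      (S := S.filter fun u => ¬ G.Adj v u) (T := S.filter (G.Adj v))
      (Finset.disjoint_filter_filter_not _ _ _).symm (by
        intro t ht U hU htU
        rw [hun] at hU
        obtain ⟨htS, hvt⟩ := Finset.mem_filter.1 ht
        exact ih U ⟨hU, fun h => htU (h htS)⟩ t htU
          ((card_filter_adj_le hG t U).2 v hvt.symm fun h => hv (hU h)))
    rw [hun] at e
    obtain ⟨W', hW', e'⟩ := hinv v W (logRegion_mono hL hη (by exact_mod_cast hcard) hW)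
    refine ⟨W', hW', ?_⟩
    rw [indepSum_insert G w hv, ← e', e, Complex.exp_neg]
    field_simp [Complex.exp_ne_zero]

open Classical in
lemma indepSum_ne_zero [Fintype V] [DecidableRel G.Adj] {d : ℕ}
    (hG : G.maxDegree ≤ d + 1) (hL : 0 ≤ L) (hη : 0 ≤ η)
    (hhalf : ∀ W ∈ logRegion y L η 1, 1 / 2 < (Complex.exp W).re)
    (hinv : ∀ v, ∀ W ∈ logRegion y L η d, ∃ W' ∈ logRegion y L η 1,
      1 + w v * Complex.exp (-W) = Complex.exp W') (S : Finset V) : indepSum G w S ≠ 0 := by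
  have hins := exists_log_ratio_of_insert hG hL hη hinv
  induction S using Finset.induction_on with
  | empty => simp [indepSum_empty]
  | insert v S hv ih =>
    rcases le_or_gt (S.filter (G.Adj v)).card d with hcard | hcard
    · obtain ⟨W, -, e⟩ := hins S v hv hcard
      rw [e]
      exact mul_ne_zero (Complex.exp_ne_zero _) ih
    -- With `d + 1` neighbours, split off one neighbour `t` and apply the invariance to the others:
    -- vanishing would force `e^{W₁} + e^{W'} = 1`, while both real parts exceed `1/2`.
    obtain ⟨t, ht⟩ := Finset.card_pos.1 (show 0 < (S.filter (G.Adj v)).card by omega)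
    set T := (S.filter (G.Adj v)).erase t with hT
    set R := S.filter fun u => ¬ G.Adj v u with hR
    have hTcard : T.card ≤ d := by
      rw [hT, Finset.card_erase_of_mem ht]
      have := (card_filter_adj_le hG v S).1
      omega
    have hstep : ∀ t ∈ S.filter (G.Adj v), ∀ U ⊆ S, t ∉ U →
        ∃ W ∈ logRegion y L η 1, indepSum G w (insert t U) = Complex.exp W * indepSum G w U := by
      intro t ht U hU htU
      exact hins U t htU ((card_filter_adj_le hG t U).2 v (Finset.mem_filter.1 ht).2.symm
        fun h => hv (hU h))
    have hdisj : Disjoint R (S.filter (G.Adj v)) := (Finset.disjoint_filter_filter_not _ _ _).symm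
    have hRT : R ∪ T ⊆ S :=
      Finset.union_subset (Finset.filter_subset _ _)
        ((Finset.erase_subset _ _).trans (Finset.filter_subset _ _))
    obtain ⟨W, hW, e⟩ := exists_log_ratio_of_union (G := G) (w := w) (y := y) (L := L) (η := η)
      (S := R) (T := T) (hdisj.mono_right (Finset.erase_subset _ _))
      fun t' ht' U hU => hstep t' (Finset.mem_of_mem_erase ht') U (hU.trans hRT)
    have htRT : t ∉ R ∪ T := by
      rw [Finset.mem_union, not_or]
      exact ⟨Finset.disjoint_right.1 hdisj ht, Finset.notMem_erase _ _⟩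
    obtain ⟨W₁, hW₁, e₁⟩ := hstep t ht (R ∪ T) hRT htRT
    have hS : insert t (R ∪ T) = S := by
      rw [← Finset.union_insert, hT, Finset.insert_erase ht, hR, Finset.union_comm,
        Finset.filter_union_filter_not_eq]
    obtain ⟨W', hW', e'⟩ := hinv v W (logRegion_mono hL hη (by exact_mod_cast hTcard) hW)
    rw [hS, e] at e₁
    have hR0 : indepSum G w R ≠ 0 := by
      intro h
      rw [h] at e₁
      exact ih (by rw [e₁]; ring)
    have hsum : indepSum G w (insert v S) =
        Complex.exp W * indepSum G w R * (Complex.exp W₁ + Complex.exp W' - 1) := by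
      rw [indepSum_insert G w hv, ← hR, ← e', e₁, Complex.exp_neg]
      field_simp [Complex.exp_ne_zero]
      ring
    rw [hsum]
    refine mul_ne_zero (mul_ne_zero (Complex.exp_ne_zero _) hR0) fun h => ?_
    have hre := congrArg Complex.re h
    simp only [Complex.sub_re, Complex.add_re, Complex.one_re, Complex.zero_re] at hre
    linarith [hhalf W₁ hW₁, hhalf W' hW']

end Induction

theorem mainTheorem2 (Δ : ℕ) (hΔ : 3 ≤ Δ) (ε : ℝ) (hε : 0 < ε) :
    ∃ δ : ℝ, 0 < δ ∧
      ∀ (V : Type*) [Fintype V] (G : SimpleGraph V) [DecidableRel G.Adj],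
        G.maxDegree ≤ Δ →
        ∀ w : V → ℂ,
          (∀ v : V, w v ∈ Metric.thickening δ
            (Complex.ofReal '' Set.Ico (0 : ℝ) ((1 - ε) * lambdaCrit Δ))) →
          indepPoly G w ≠ 0 := by
  obtain ⟨d, rfl⟩ : ∃ d, Δ = d + 1 := ⟨Δ - 1, by omega⟩
  have hd : 2 ≤ d := by omega
  have hd1 : (1 : ℝ) < d := by exact_mod_cast (show 1 < d by omega)
  obtain ⟨hΛ0, hΛ⟩ := log_lambdaCrit hd
  -- Replacing `1 - ε` by `max (1 - ε) (1 / 2)` keeps the upper endpoint positive when `ε ≥ 1`.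
  have hmax : max (1 - ε) (1 / 2) < 1 := max_lt (by linarith) (by norm_num)
  have hmax0 : 0 < max (1 - ε) (1 / 2) := lt_max_of_lt_right (by norm_num)
  obtain ⟨L, η, δ, hL, hη, hδ, hhalf, hinv⟩ := exists_invariant_region hd1
    (mul_pos hmax0 hΛ0) (mul_lt_of_lt_one_left hΛ0 hmax) hΛ
  refine ⟨δ, hδ, fun V _ G _ hG w hw => ?_⟩
  rw [indepPoly_eq_indepSum_univ]
  refine indepSum_ne_zero hG hL hη.le hhalf (fun v => hinv (w v) ?_) _
  refine Metric.thickening_subset_of_subset δ (Set.image_mono (Set.Ico_subset_Ico_right ?_)) (hw v)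
  gcongr
  exact le_max_left _ _
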